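/- **Model.** There are $N\ge 2$ users, a benefit $b$ and a cost $c$ with $0<c<b$, a report error $\varepsilon\in(0,\tfrac12)$ and a discount factor $\delta\in[0,1)$. Each user has a rating in $\{0,1\}$. The distribution $\boldsymbol s(\boldsymbol\theta)=(s_0,s_1)$ of a rating profile $\boldsymbol\theta\in\{0,1\}^N$ counts the users of each rating; $S$ is the set of all distributions. A plan is a map $\alpha:\{0,1\}^2\to\{0,1\}$, where $\alpha(\theta_c,\theta_s)=1$ ($=0$) means that a server of rating $\theta_s$ gives high (low) quality to a client of rating $\theta_c$. The altruistic plan is $\alpha^{\rm a}\equiv1$, the selfish plan is $\alpha^{\rm s}\equiv 0$, and $A^{\rm as}=\{\alpha^{\rm a},\alpha^{\rm s}\}$. In each period a plan $\alpha_0$ is recommended, and a uniformly random permutation without fixed points assigns to each user a server; high quality gives $b$ to the client and costs the server $c$. Given the matching, each server's quality is reported, independently across servers, with error probability $\varepsilon$. If the reported quality is at least the recommended one, a server of rating $\theta$ gets rating $1$ with probability $\beta^+_\theta$ (otherwise $0$); if it is lower than recommended, it gets rating $0$ with probability $\beta^-_\theta$ (otherwise $1$). The update rule is $\tau=(\beta_0^+,\beta_1^+,\beta_0^-,\beta_1^-)\in[0,1]^4$.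 A strategy maps histories $(\boldsymbol s^0,\dots,\boldsymbol s^t)$ of rating distributions to plans; it may be nonstationary. $U_i(\boldsymbol\theta^0,\pi_0,\boldsymbol\pi)$ is the expected value of $(1-\delta)\sum_{t\ge0}\delta^t u_i^t$, where $u_i^t$ is user $i$'s expected payoff in period $t$, given the initial profile $\boldsymbol\theta^0$, the recommended strategy $\pi_0$ and the users' strategies $\boldsymbol\pi$. A recommended strategy $\pi_0$ is an equilibrium (PAE) if after every history of past distributions and at every current rating profile no user can gain, in the continuation, by deviating from $\pi_0$ to any strategy, while all the others follow $\pi_0$. Let $$W(\varepsilon,\delta,A^{\rm as})=\sup_{\tau,\pi_0}\ \min_{\boldsymbol\theta^0}\ \frac1N\sum_{i}U_i(\boldsymbol\theta^0,\pi_0,\pi_0\cdot\boldsymbol 1_N),$$ the supremum being over all update rules $\tau$ and all strategies $\pi_0$ with values in $A^{\rm as}$ such that $\pi_0$ is an equilibrium. **The loss.** Write $q_\tau(T\mid\boldsymbol\theta,\alpha_0,\boldsymbol\alpha)$ for the probability that the next rating distribution lies in $T\subseteq S$ when the profile is $\boldsymbol\theta$, the plan $\alpha_0$ is recommended and the users use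 the plans $\boldsymbol\alpha$. For a nonempty $D\subseteq\{0,1\}$ let $\alpha^D$ be the plan of serving exactly the clients with rating outside $D$, let $p_{i,D}(\boldsymbol\theta)=\frac{\#\{j\ne i:\ \theta_j\in D\}}{N-1}$ be the probability that $i$'s client has a rating in $D$, and let $$g_{i,D}=q_\tau(S\setminus T\mid\boldsymbol\theta,\alpha_0,\alpha^{\rm a}\cdot\boldsymbol1_N)-q_\tau(S\setminus T\mid\boldsymbol\theta,\alpha_0,(\alpha_i=\alpha^D,\alpha^{\rm a}\cdot\boldsymbol1_{N-1})).$$ Call $(\tau,\boldsymbol\theta,\alpha_0,T)$ with $\alpha_0\in A^{\rm as}$ feasible if $g_{i,D}>0$ whenever $p_{i,D}(\boldsymbol\theta)>0$, and put $\rho=\max\{p_{i,D}(\boldsymbol\theta)/g_{i,D}:\ p_{i,D}(\boldsymbol\theta)>0\}$. Define $$\zeta(\varepsilon)=\min\Big\{b-c,\ \ c\cdot\inf_{(\tau,\boldsymbol\theta,\alpha_0,T)\text{ feasible}}\ \rho\cdot q_\tau(T\mid\boldsymbol\theta,\alpha_0,\alpha^{\rm a}\cdot\boldsymbol 1_N)\Big\},$$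 which does not depend on $\delta$. **Proposition 1.** For every $\varepsilon\in(0,\tfrac12)$ we have $\zeta(\varepsilon)>0$. For every $\delta\in[0,1)$ the supremum $W(\varepsilon,\delta,A^{\rm as})$ is over a nonempty bounded set, the limit of $W(\varepsilon,\delta,A^{\rm as})$ as $\delta\to1$ exists, and $$\lim_{\delta\to1}W(\varepsilon,\delta,A^{\rm as})\ \le\ b-c-\zeta(\varepsilon).$$ -/

import Mathlib

open Filter Topology

noncomputable section

namespace RatingMechanism

/-- Binary ratings. -/
abbrev Rating := Fin 2

/-- Service qualities and reports: `0` is low quality, `1` is high quality. -/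
abbrev Quality := Fin 2

/-- A plan: `α θc θs` is the quality chosen by a server of rating `θs` for a client of
rating `θc`. -/
abbrev Plan := Rating → Rating → Quality

/-- Rating profiles of the `N` users. -/
abbrev Profile (N : ℕ) := Fin N → Rating

/-- Rating distributions `(s₀, s₁)` with `s₀ + s₁ = N`, encoded by `s₁`, the number of users
of rating `1`. -/
abbrev Dist (N : ℕ) := Fin (N + 1)

/-- The rating distribution of a rating profile. -/
def ratingDist {N : ℕ} (θ : Profile N) : Dist N :=
  ⟨(Finset.univ.filter (fun i => θ i = 1)).card,
    Nat.lt_succ_of_le ((Finset.card_le_univ _).trans (by simp))⟩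

/-- The altruistic plan. -/
def altruistic : Plan := fun _ _ => 1

/-- The selfish plan. -/
def selfish : Plan := fun _ _ => 0

/-- The set consisting of the altruistic and the selfish plan. -/
def planAS : Set Plan := {altruistic, selfish}

/-- The parameters `β_θ⁺`, `β_θ⁻` of a rating update rule. -/
structure UpdateRule where
  betaPlus : Rating → unitInterval
  betaMinus : Rating → unitInterval

/-- `R(r | q)`: probability of the report `r` when the actual quality is `q`. -/
def reportProb (ε : ℝ) (r q : Quality) : ℝ := if r = q then 1 - ε else ε

/-- `τ(θ' | θc, θs, r, α₀)`: probability that the server's updated rating is `θ'`. -/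
def updateProb (τ : UpdateRule) (θ' θc θs : Rating) (r : Quality) (α₀ : Plan) : ℝ :=
  if α₀ θc θs ≤ r then
    (if θ' = 1 then (τ.betaPlus θs : ℝ) else 1 - (τ.betaPlus θs : ℝ))
  else
    (if θ' = 1 then 1 - (τ.betaMinus θs : ℝ) else (τ.betaMinus θs : ℝ))

/-- Probability that a server of rating `θs` who provides quality `q` to a client of rating `θc`
has rating `θ'` in the next period. -/
def serverProb (ε : ℝ) (τ : UpdateRule) (α₀ : Plan) (θ' θc θs : Rating) (q : Quality) : ℝ :=
  ∑ r : Quality, reportProb ε r q * updateProb τ θ' θc θs r α₀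

/-- Expectation under the uniformly random matching. A matching is a permutation `m` without
fixed points; `m i` is the server of the client `i`, so that `m.symm j` is the client of the
server `j`. -/
def matchAvg (N : ℕ) (f : Equiv.Perm (Fin N) → ℝ) : ℝ :=
  (∑ m : derangements (Fin N), f m) / (Fintype.card (derangements (Fin N)) : ℝ)

/-- User `i`'s expected payoff in one period at the rating profile `θ` and the plan profile `α`:
benefit `b` from receiving high quality, cost `c` of providing it. -/
def stagePayoff {N : ℕ} (b c : ℝ) (i : Fin N) (θ : Profile N) (α : Fin N → Plan) : ℝ :=
  matchAvg N fun m =>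
    b * (((α (m i) (θ i) (θ (m i))) : ℕ) : ℝ) - c * (((α i (θ (m.symm i)) (θ i)) : ℕ) : ℝ)

/-- `q(θ' | θ, α₀, α)`: transition probability between rating profiles. Given the matching, the
ratings are updated independently. -/
def stateTrans {N : ℕ} (ε : ℝ) (τ : UpdateRule) (θ : Profile N) (α₀ : Plan) (α : Fin N → Plan)
    (θ' : Profile N) : ℝ :=
  matchAvg N fun m =>
    ∏ j, serverProb ε τ α₀ (θ' j) (θ (m.symm j)) (θ j) (α j (θ (m.symm j)) (θ j))

/-- A (nonstationary) strategy: `π h s` is the plan chosen in period `t` after the history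
`(s⁰, …, sᵗ)` of rating distributions, where `h = [s⁰, …, sᵗ⁻¹]` and `s = sᵗ`. -/
abbrev Strategy (N : ℕ) := List (Dist N) → Dist N → Plan

/-- The strategies that use only plans of the set `B`. -/
def strategiesIn {N : ℕ} (B : Set Plan) : Set (Strategy N) := {π | ∀ h s, π h s ∈ B}

/-- The continuation of a strategy after the rating distributions in `h` have occurred. -/
def continuation {N : ℕ} (π : Strategy N) (h : List (Dist N)) : Strategy N :=
  fun k s => π (h ++ k) s

/-- The expected payoff of user `i` in the period that lies `t` periods ahead, when the current
rating profile is `θ`, the past rating distributions are `h`, the recommended strategy is `π₀`,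
and user `j` follows the strategy `π j`. -/
def expPayoff {N : ℕ} (b c ε : ℝ) (τ : UpdateRule) (π₀ : Strategy N) (π : Fin N → Strategy N)
    (i : Fin N) : ℕ → List (Dist N) → Profile N → ℝ
  | 0, h, θ => stagePayoff b c i θ (fun j => π j h (ratingDist θ))
  | t + 1, h, θ =>
      ∑ θ' : Profile N, stateTrans ε τ θ (π₀ h (ratingDist θ)) (fun j => π j h (ratingDist θ)) θ' *
        expPayoff b c ε τ π₀ π i t (h ++ [ratingDist θ]) θ'

/-- The discounted average payoff `U_i(θ, π₀, π)`. -/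
def discountedPayoff {N : ℕ} (b c ε δ : ℝ) (τ : UpdateRule) (i : Fin N) (θ : Profile N)
    (π₀ : Strategy N) (π : Fin N → Strategy N) : ℝ :=
  (1 - δ) * ∑' t : ℕ, δ ^ t * expPayoff b c ε τ π₀ π i t [] θ

/-- Public announcement equilibrium: after every history of past rating distributions and at every
current rating profile, no user gains by deviating to any strategy whatsoever, when all the other
users follow the recommended strategy. -/
def IsPAE {N : ℕ} (b c ε δ : ℝ) (τ : UpdateRule) (π₀ : Strategy N) : Prop :=
  ∀ (h : List (Dist N)) (θ : Profile N) (i : Fin N) (π' : Strategy N),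
    discountedPayoff b c ε δ τ i θ (continuation π₀ h)
        (Function.update (fun _ => continuation π₀ h) i π') ≤
      discountedPayoff b c ε δ τ i θ (continuation π₀ h) (fun _ => continuation π₀ h)

/-- The social welfare when everybody follows `π₀`, in the worst case over the initial rating
profiles. -/
def worstWelfare {N : ℕ} (b c ε δ : ℝ) (τ : UpdateRule) (π₀ : Strategy N) : ℝ :=
  ⨅ θ : Profile N, (1 / (N : ℝ)) * ∑ i, discountedPayoff b c ε δ τ i θ π₀ (fun _ => π₀)

/-- The values of the objective over the feasible points of the design problem. -/
def equilibriumWelfares (N : ℕ) (b c ε δ : ℝ) (B : Set Plan) : Set ℝ :=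
  {w | ∃ (τ : UpdateRule) (π₀ : Strategy N),
    π₀ ∈ strategiesIn B ∧ IsPAE b c ε δ τ π₀ ∧ w = worstWelfare b c ε δ τ π₀}

/-- The optimal equilibrium social welfare `W(ε, δ, B)`. -/
def optimalWelfare (N : ℕ) (b c ε δ : ℝ) (B : Set Plan) : ℝ :=
  sSup (equilibriumWelfares N b c ε δ B)

/-! ### The welfare loss -/

/-- The plan of serving exactly the clients whose rating is not in `D`: for `D = {0}`, `{1}` and
`{0, 1}` these are the three ways of shirking under the altruistic plan. -/
def refuse (D : Finset Rating) : Plan := fun θc _ => if θc ∈ D then 0 else 1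

/-- The probability that the client of user `i` has a rating in `D`. -/
def clientProb {N : ℕ} (θ : Profile N) (i : Fin N) (D : Finset Rating) : ℝ :=
  ((Finset.univ.filter (fun j => j ≠ i ∧ θ j ∈ D)).card : ℝ) / ((N : ℝ) - 1)

/-- The probability that the next rating distribution lies in `T`. -/
def distTrans {N : ℕ} (ε : ℝ) (τ : UpdateRule) (θ : Profile N) (α₀ : Plan) (α : Fin N → Plan)
    (T : Finset (Dist N)) : ℝ :=
  ∑ θ' ∈ Finset.univ.filter (fun θ' : Profile N => ratingDist θ' ∈ T), stateTrans ε τ θ α₀ α θ'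

/-- The amount by which the probability that the next rating distribution avoids `T` drops, when
everybody else is altruistic and user `i` refuses to serve the clients with rating in `D`. -/
def gap {N : ℕ} (ε : ℝ) (τ : UpdateRule) (θ : Profile N) (α₀ : Plan) (T : Finset (Dist N))
    (i : Fin N) (D : Finset Rating) : ℝ :=
  distTrans ε τ θ α₀ (fun _ => altruistic) Tᶜ -
    distTrans ε τ θ α₀ (Function.update (fun _ => altruistic) i (refuse D)) Tᶜ

/-- Every way of shirking that takes effect with positive probability makes it strictly less
likely that the next rating distribution avoids `T`. -/
def Detects {N : ℕ} (ε : ℝ) (τ : UpdateRule) (θ : Profile N) (α₀ : Plan)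
    (T : Finset (Dist N)) : Prop :=
  ∀ (i : Fin N) (D : Finset Rating), 0 < clientProb θ i D → 0 < gap ε τ θ α₀ T i D

/-- `ρ(θ, α₀, T)`: the largest ratio of the (normalized) gain from shirking to its effect on the
probability of avoiding `T`. A deviation that never takes effect contributes `0 / 0 = 0`, hence
does not influence the maximum. -/
def rho {N : ℕ} (ε : ℝ) (τ : UpdateRule) (θ : Profile N) (α₀ : Plan)
    (T : Finset (Dist N)) : ℝ :=
  ⨆ p : Fin N × {D : Finset Rating // D.Nonempty},
    clientProb θ p.1 p.2 / gap ε τ θ α₀ T p.1 p.2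

/-- The values of `ρ(θ, α₀, T) * ∑_{s' ∈ T} q(s' | θ, α₀, αᵃ)` over all rating update rules, rating
profiles, recommended plans and feasible punishment sets. -/
def lossValues (N : ℕ) (ε : ℝ) : Set ℝ :=
  {x | ∃ (τ : UpdateRule) (θ : Profile N) (α₀ : Plan) (T : Finset (Dist N)),
    α₀ ∈ planAS ∧ Detects ε τ θ α₀ T ∧
      x = rho ε τ θ α₀ T * distTrans ε τ θ α₀ (fun _ => altruistic) T}

/-- The guaranteed welfare loss `ζ(ε)`; it cannot exceed `b - c`, because zero welfare is always
attainable. -/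
def zeta (N : ℕ) (b c ε : ℝ) : ℝ := min (b - c) (c * sInf (lossValues N ε))

end RatingMechanism

end

open RatingMechanism

/-!
The proof computes everything exactly: the loss is `min (b - c) (c ε / (1 - 2ε))`, and the optimal
welfare is at most `b - c` minus the loss for every discount factor, with equality for all
discount factors close to `1`.

*Bound on the loss and on the welfare.* A change of the quality that a single server provides
changes the probability of each report, hence of each next rating profile, by a factor of at most
`(1 - ε) / ε` (`stateTrans_update_le`). If a punishment set has probability `Q` under the
altruistic plan, then total shirking raises its probability by at most `(1 - 2ε) / ε * Q`, which
gives `ρ Q ≥ ε / (1 - 2ε)` (`le_of_mem_lossValues`). The same inequality, applied to the shortfall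
of the continuation values from their upper bound instead of an indicator function, shows that
enforcing altruism for one period costs every user at least `(1 - δ) c ε / (1 - 2ε)` in expected
continuation value (`IsPAE.valueAt_le`).

*Attainment.* When the new rating is just the reported quality, the event that all ratings drop
to `0` has the likelihood ratio `(1 - ε) / ε` against every user, at every rating profile
(`stateTrans_reportRule_zero`). So it attains the smallest loss (`mem_lossValues`). It also
supports an equilibrium of value `w = b - c - c ε / (1 - 2ε)` if `w ≥ 0` and the users are patient
(`mem_equilibriumWelfares_of_patient`): the strategy keeps track of a promised value in `[0, w]`;
small promises are kept by a selfish period, large ones by an altruistic period after which the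
promise is reduced by just enough to make all users indifferent if all ratings have dropped to
`0`. If `w ≤ 0`, the selfish plan forever attains the bound `0`.
-/

namespace RatingMechanism

variable {N : ℕ} {b c ε δ w x v : ℝ} {τ : UpdateRule}

/-! ### The uniformly random matching -/

lemma card_derangements_pos (hN : 2 ≤ N) :
    0 < (Fintype.card (derangements (Fin N)) : ℝ) := by
  have : Nonempty (derangements (Fin N)) := by
    refine ⟨finRotate N, fun i => ?_⟩
    have h : i ∈ (finRotate N).support := by simp [support_finRotate_of_le hN]
    exact Equiv.Perm.mem_support.1 h
  exact_mod_cast Fintype.card_pos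

lemma matchAvg_mono {f g : Equiv.Perm (Fin N) → ℝ}
    (h : ∀ m ∈ derangements (Fin N), f m ≤ g m) : matchAvg N f ≤ matchAvg N g := by
  unfold matchAvg
  gcongr with m
  exact h m m.2

lemma matchAvg_congr {f g : Equiv.Perm (Fin N) → ℝ}
    (h : ∀ m ∈ derangements (Fin N), f m = g m) : matchAvg N f = matchAvg N g :=
  le_antisymm (matchAvg_mono fun m hm => (h m hm).le) (matchAvg_mono fun m hm => (h m hm).ge)

lemma matchAvg_affine (hN : 2 ≤ N) (p q : ℝ) (f : Equiv.Perm (Fin N) → ℝ) :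
    matchAvg N (fun m => p + q * f m) = p + q * matchAvg N f := by
  have := card_derangements_pos hN
  unfold matchAvg
  rw [Finset.sum_add_distrib, ← Finset.mul_sum]
  simp only [Finset.sum_const, Finset.card_univ, nsmul_eq_mul]
  field_simp

lemma matchAvg_const (hN : 2 ≤ N) (p : ℝ) : matchAvg N (fun _ => p) = p := by
  simpa using matchAvg_affine hN p 0 (fun _ => 0)

lemma matchAvg_mul_left (p : ℝ) (f : Equiv.Perm (Fin N) → ℝ) :
    matchAvg N (fun m => p * f m) = p * matchAvg N f := by
  unfold matchAvg
  rw [← Finset.mul_sum, mul_div_assoc]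

lemma sum_matchAvg {ι : Type*} (s : Finset ι) (f : ι → Equiv.Perm (Fin N) → ℝ) :
    ∑ k ∈ s, matchAvg N (f k) = matchAvg N (fun m => ∑ k ∈ s, f k m) := by
  unfold matchAvg
  rw [← Finset.sum_div, Finset.sum_comm]

/-! ### Transition probabilities and the likelihood ratio bound -/

lemma reportProb_nonneg (hε : 0 < ε) (hε' : ε < 1 / 2) (r q : Quality) :
    0 ≤ reportProb ε r q := by
  unfold reportProb; split_ifs <;> linarith

lemma updateProb_nonneg (τ : UpdateRule) (θ' θc θs : Rating) (r : Quality) (α₀ : Plan) :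
    0 ≤ updateProb τ θ' θc θs r α₀ := by
  have h1 := (τ.betaPlus θs).2
  have h2 := (τ.betaMinus θs).2
  unfold updateProb
  split_ifs <;> linarith [h1.1, h1.2, h2.1, h2.2]

lemma serverProb_nonneg (hε : 0 < ε) (hε' : ε < 1 / 2) (τ : UpdateRule) (α₀ : Plan)
    (θ' θc θs : Rating) (q : Quality) : 0 ≤ serverProb ε τ α₀ θ' θc θs q :=
  Finset.sum_nonneg fun r _ =>
    mul_nonneg (reportProb_nonneg hε hε' r q) (updateProb_nonneg τ θ' θc θs r α₀)

lemma sum_serverProb (ε : ℝ) (τ : UpdateRule) (α₀ : Plan) (θc θs : Rating) (q : Quality) :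
    ∑ θ' : Rating, serverProb ε τ α₀ θ' θc θs q = 1 := by
  have hu (r : Quality) : ∑ θ' : Rating, updateProb τ θ' θc θs r α₀ = 1 := by
    simp only [Fin.sum_univ_two, updateProb]
    split_ifs <;> simp_all
  unfold serverProb
  rw [Finset.sum_comm]
  simp only [← Finset.mul_sum, hu, mul_one]
  fin_cases q <;> simp [Fin.sum_univ_two, reportProb]

/-- A change of quality changes the probability of each report, hence of each new rating, by a
factor of at most `(1 - ε) / ε`. -/
lemma serverProb_le (hε : 0 < ε) (hε' : ε < 1 / 2) (τ : UpdateRule) (α₀ : Plan)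
    (θ' θc θs : Rating) (q q' : Quality) :
    serverProb ε τ α₀ θ' θc θs q' ≤ (1 - ε) / ε * serverProb ε τ α₀ θ' θc θs q := by
  unfold serverProb
  rw [Finset.mul_sum]
  refine Finset.sum_le_sum fun r _ => ?_
  rw [← mul_assoc]
  refine mul_le_mul_of_nonneg_right ?_ (updateProb_nonneg τ θ' θc θs r α₀)
  rw [div_mul_eq_mul_div, le_div_iff₀ hε]
  unfold reportProb
  split_ifs <;> nlinarith

lemma stateTrans_nonneg (hε : 0 < ε) (hε' : ε < 1 / 2) (τ : UpdateRule)
    (θ : Profile N) (α₀ : Plan) (α : Fin N → Plan) (θ' : Profile N) :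
    0 ≤ stateTrans ε τ θ α₀ α θ' :=
  div_nonneg (Finset.sum_nonneg fun _ _ => Finset.prod_nonneg fun _ _ =>
    serverProb_nonneg hε hε' _ _ _ _ _ _) (Nat.cast_nonneg _)

lemma sum_stateTrans (hN : 2 ≤ N) (ε : ℝ) (τ : UpdateRule) (θ : Profile N) (α₀ : Plan)
    (α : Fin N → Plan) : ∑ θ', stateTrans ε τ θ α₀ α θ' = 1 := by
  unfold stateTrans
  rw [sum_matchAvg]
  conv_rhs => rw [← matchAvg_const hN 1]
  congr 1
  funext m
  rw [← Fintype.prod_sum (fun j r => serverProb ε τ α₀ r (θ (m.symm j)) (θ j)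
    (α j (θ (m.symm j)) (θ j)))]
  exact Finset.prod_eq_one fun j _ => sum_serverProb _ _ _ _ _ _

/-- When a single user changes his plan, the probability of each next rating profile changes by a
factor of at most `(1 - ε) / ε`. -/
lemma stateTrans_update_le (hε : 0 < ε) (hε' : ε < 1 / 2) (τ : UpdateRule)
    (θ : Profile N) (α₀ : Plan) (α : Fin N → Plan) (i : Fin N) (α' : Plan) (θ' : Profile N) :
    stateTrans ε τ θ α₀ (Function.update α i α') θ' ≤
      (1 - ε) / ε * stateTrans ε τ θ α₀ α θ' := by
  unfold stateTrans
  rw [← matchAvg_mul_left]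
  refine matchAvg_mono fun m _ => ?_
  rw [← Finset.mul_prod_erase Finset.univ _ (Finset.mem_univ i),
    ← Finset.mul_prod_erase Finset.univ (fun j => serverProb ε τ α₀ (θ' j) (θ (m.symm j)) (θ j)
      (α j (θ (m.symm j)) (θ j))) (Finset.mem_univ i), ← mul_assoc]
  have he : ∀ j ∈ Finset.univ.erase i, Function.update α i α' j = α j := fun j hj =>
    Function.update_of_ne (Finset.ne_of_mem_erase hj) _ _
  rw [Finset.prod_congr rfl fun j hj => by rw [he j hj]]
  exact mul_le_mul_of_nonneg_right (serverProb_le hε hε' _ _ _ _ _ _ _)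
    (Finset.prod_nonneg fun _ _ => serverProb_nonneg hε hε' _ _ _ _ _ _)

/-! ### Discounted values -/

/-- The discounted average payoff from the history `h` on. For `h = []` this is
`discountedPayoff`. -/
noncomputable def valueAt (b c ε δ : ℝ) (τ : UpdateRule) (π₀ : Strategy N)
    (π : Fin N → Strategy N) (i : Fin N) (h : List (Dist N)) (θ : Profile N) : ℝ :=
  (1 - δ) * ∑' t : ℕ, δ ^ t * expPayoff b c ε τ π₀ π i t h θ

/-- Payoffs depend on the strategies only through the plans prescribed from the current history on.
This identifies payoffs of continuation strategies with payoffs after the history, and removes a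
deviation that lies in the past. -/
lemma expPayoff_congr {π₀ π₀' : Strategy N} {π π' : Fin N → Strategy N} {h h' : List (Dist N)}
    (h₀ : ∀ k s, π₀ (h ++ k) s = π₀' (h' ++ k) s)
    (h₁ : ∀ j k s, π j (h ++ k) s = π' j (h' ++ k) s) (i : Fin N) (t : ℕ) (θ : Profile N) :
    expPayoff b c ε τ π₀ π i t h θ = expPayoff b c ε τ π₀' π' i t h' θ := by
  induction t generalizing h h' θ with
  | zero =>
    have := fun j s => h₁ j [] s
    simp only [List.append_nil] at this
    simp only [expPayoff, this]
  | succ t ih =>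
    have e₀ := h₀ []
    have e₁ := fun j => h₁ j []
    simp only [List.append_nil] at e₀ e₁
    simp only [expPayoff, e₀, e₁]
    refine Finset.sum_congr rfl fun θ' _ => ?_
    rw [ih (h := h ++ [ratingDist θ]) (h' := h' ++ [ratingDist θ])]
    · intro k s; simpa using h₀ (ratingDist θ :: k) s
    · intro j k s; simpa using h₁ j (ratingDist θ :: k) s

lemma valueAt_congr {π₀ π₀' : Strategy N} {π π' : Fin N → Strategy N} {h h' : List (Dist N)}
    (h₀ : ∀ k s, π₀ (h ++ k) s = π₀' (h' ++ k) s)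
    (h₁ : ∀ j k s, π j (h ++ k) s = π' j (h' ++ k) s) (i : Fin N) (θ : Profile N) :
    valueAt b c ε δ τ π₀ π i h θ = valueAt b c ε δ τ π₀' π' i h' θ := by
  simp only [valueAt, expPayoff_congr h₀ h₁]

lemma abs_stagePayoff_le (hN : 2 ≤ N) (hb : 0 ≤ b) (hc : 0 ≤ c) (i : Fin N) (θ : Profile N)
    (α : Fin N → Plan) : |stagePayoff b c i θ α| ≤ b + c := by
  have hq : ∀ q : Quality, (0 : ℝ) ≤ ((q : ℕ) : ℝ) ∧ ((q : ℕ) : ℝ) ≤ 1 := by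
    intro q; fin_cases q <;> simp
  unfold stagePayoff
  refine abs_le.2 ⟨(matchAvg_const hN (-(b + c))).ge.trans (matchAvg_mono fun m _ => ?_),
    (matchAvg_mono fun m _ => ?_).trans (matchAvg_const hN (b + c)).le⟩
  all_goals
    obtain ⟨h1, h2⟩ := hq (α (m i) (θ i) (θ (m i)))
    obtain ⟨h3, h4⟩ := hq (α i (θ (m.symm i)) (θ i))
    nlinarith

lemma abs_expPayoff_le (hN : 2 ≤ N) (hb : 0 ≤ b) (hc : 0 ≤ c) (hε : 0 < ε) (hε' : ε < 1 / 2)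
    (π₀ : Strategy N) (π : Fin N → Strategy N) (i : Fin N) (t : ℕ) (h : List (Dist N))
    (θ : Profile N) : |expPayoff b c ε τ π₀ π i t h θ| ≤ b + c := by
  induction t generalizing h θ with
  | zero => exact abs_stagePayoff_le hN hb hc i θ _
  | succ t ih =>
    refine (Finset.abs_sum_le_sum_abs _ _).trans ?_
    refine (Finset.sum_le_sum (g := fun θ' => stateTrans ε τ θ (π₀ h (ratingDist θ))
      (fun j => π j h (ratingDist θ)) θ' * (b + c)) fun θ' _ => ?_).trans ?_
    · rw [abs_mul, abs_of_nonneg (stateTrans_nonneg hε hε' _ _ _ _ _)]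
      exact mul_le_mul_of_nonneg_left (ih _ _) (stateTrans_nonneg hε hε' _ _ _ _ _)
    · rw [← Finset.sum_mul, sum_stateTrans hN, one_mul]

lemma summable_expPayoff (hN : 2 ≤ N) (hb : 0 ≤ b) (hc : 0 ≤ c) (hε : 0 < ε) (hε' : ε < 1 / 2)
    (hδ : 0 ≤ δ) (hδ' : δ < 1) (π₀ : Strategy N) (π : Fin N → Strategy N) (i : Fin N)
    (h : List (Dist N)) (θ : Profile N) :
    Summable fun t : ℕ => δ ^ t * expPayoff b c ε τ π₀ π i t h θ := by
  refine Summable.of_norm_bounded (g := fun t : ℕ => δ ^ t * (b + c))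
    ((summable_geometric_of_lt_one hδ hδ').mul_right _) fun t => ?_
  rw [Real.norm_eq_abs, abs_mul, abs_of_nonneg (pow_nonneg hδ t)]
  exact mul_le_mul_of_nonneg_left (abs_expPayoff_le hN hb hc hε hε' _ _ _ _ _ _)
    (pow_nonneg hδ t)

lemma abs_valueAt_le (hN : 2 ≤ N) (hb : 0 ≤ b) (hc : 0 ≤ c) (hε : 0 < ε) (hε' : ε < 1 / 2)
    (hδ : 0 ≤ δ) (hδ' : δ < 1) (π₀ : Strategy N) (π : Fin N → Strategy N) (i : Fin N)
    (h : List (Dist N)) (θ : Profile N) :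
    |valueAt b c ε δ τ π₀ π i h θ| ≤ b + c := by
  unfold valueAt
  have hg := hasSum_geometric_of_lt_one hδ hδ'
  have key : ‖∑' t : ℕ, δ ^ t * expPayoff b c ε τ π₀ π i t h θ‖ ≤ (1 - δ)⁻¹ * (b + c) := by
    refine tsum_of_norm_bounded (hg.mul_right (b + c)) fun t => ?_
    rw [Real.norm_eq_abs, abs_mul, abs_of_nonneg (pow_nonneg hδ t)]
    exact mul_le_mul_of_nonneg_left (abs_expPayoff_le hN hb hc hε hε' _ _ _ _ _ _)
      (pow_nonneg hδ t)
  have h1 : 0 < 1 - δ := by linarith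
  rw [abs_mul, abs_of_pos h1]
  calc (1 - δ) * |_| ≤ (1 - δ) * ((1 - δ)⁻¹ * (b + c)) := mul_le_mul_of_nonneg_left key h1.le
    _ = b + c := by rw [← mul_assoc, mul_inv_cancel₀ h1.ne', one_mul]

/-- The Bellman recursion. -/
lemma valueAt_eq (hN : 2 ≤ N) (hb : 0 ≤ b) (hc : 0 ≤ c) (hε : 0 < ε) (hε' : ε < 1 / 2)
    (hδ : 0 ≤ δ) (hδ' : δ < 1) (π₀ : Strategy N) (π : Fin N → Strategy N) (i : Fin N)
    (h : List (Dist N)) (θ : Profile N) :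
    valueAt b c ε δ τ π₀ π i h θ =
      (1 - δ) * stagePayoff b c i θ (fun j => π j h (ratingDist θ)) +
      δ * ∑ θ', stateTrans ε τ θ (π₀ h (ratingDist θ)) (fun j => π j h (ratingDist θ)) θ' *
        valueAt b c ε δ τ π₀ π i (h ++ [ratingDist θ]) θ' := by
  have hs := fun h θ => summable_expPayoff (τ := τ) hN hb hc hε hε' hδ hδ' π₀ π i h θ
  unfold valueAt
  rw [(hs h θ).tsum_eq_zero_add]
  simp only [expPayoff, pow_zero, one_mul]
  rw [mul_add]
  congr 1
  have e : ∀ t : ℕ, δ ^ (t + 1) * ∑ θ', stateTrans ε τ θ (π₀ h (ratingDist θ))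
      (fun j => π j h (ratingDist θ)) θ' *
        expPayoff b c ε τ π₀ π i t (h ++ [ratingDist θ]) θ' =
      ∑ θ', (δ * stateTrans ε τ θ (π₀ h (ratingDist θ)) (fun j => π j h (ratingDist θ)) θ') *
        (δ ^ t * expPayoff b c ε τ π₀ π i t (h ++ [ratingDist θ]) θ') := by
    intro t
    rw [Finset.mul_sum]
    exact Finset.sum_congr rfl fun _ _ => by ring
  simp only [e]
  rw [Summable.tsum_finsetSum fun θ' _ => (hs _ θ').mul_left _, Finset.mul_sum, Finset.mul_sum]
  refine Finset.sum_congr rfl fun θ' _ => ?_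
  rw [tsum_mul_left]
  ring

/-- The contraction argument: a function that is bounded below, and at each point at least `δ`
times each of its lower bounds, is nonnegative. -/
lemma nonneg_of_discounted {ι : Type*} (hδ' : δ < 1) (d : ι → ℝ) (B : ℝ)
    (hB : ∀ a, B ≤ d a) (H : ∀ a m, (∀ a', m ≤ d a') → δ * m ≤ d a) (a : ι) : 0 ≤ d a := by
  have : Nonempty ι := ⟨a⟩
  have hbdd : BddBelow (Set.range d) := ⟨B, by rintro _ ⟨a, rfl⟩; exact hB a⟩
  have hle : ∀ a, iInf d ≤ d a := fun a => ciInf_le hbdd a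
  have h2 : δ * iInf d ≤ iInf d := le_ciInf fun a => H a _ hle
  have h3 : 0 ≤ iInf d := by nlinarith
  exact h3.trans (hle a)

lemma nonneg_of_excessive (hN : 2 ≤ N) (hε : 0 < ε) (hε' : ε < 1 / 2)
    (hδ : 0 ≤ δ) (hδ' : δ < 1) (π₀ : Strategy N) (π : Fin N → Strategy N)
    (d : List (Dist N) → Profile N → ℝ) (B : ℝ) (hB : ∀ h θ, B ≤ d h θ)
    (hd : ∀ h θ, δ * ∑ θ', stateTrans ε τ θ (π₀ h (ratingDist θ))
      (fun j => π j h (ratingDist θ)) θ' * d (h ++ [ratingDist θ]) θ' ≤ d h θ)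
    (h : List (Dist N)) (θ : Profile N) : 0 ≤ d h θ := by
  refine nonneg_of_discounted hδ' (fun p : List (Dist N) × Profile N => d p.1 p.2) B
    (fun p => hB _ _) ?_ (h, θ)
  rintro ⟨h, θ⟩ m hm
  refine le_trans (mul_le_mul_of_nonneg_left ?_ hδ) (hd h θ)
  calc m = ∑ θ', stateTrans ε τ θ (π₀ h (ratingDist θ))
        (fun j => π j h (ratingDist θ)) θ' * m := by
        rw [← Finset.sum_mul, sum_stateTrans hN, one_mul]
    _ ≤ _ := Finset.sum_le_sum fun θ' _ => mul_le_mul_of_nonneg_left (hm (_, θ'))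
        (stateTrans_nonneg hε hε' _ _ _ _ _)

/-- Verification: a function that does not increase under the Bellman operator of the strategies
`π` dominates their value. -/
lemma valueAt_le (hN : 2 ≤ N) (hb : 0 ≤ b) (hc : 0 ≤ c) (hε : 0 < ε) (hε' : ε < 1 / 2)
    (hδ : 0 ≤ δ) (hδ' : δ < 1) (π₀ : Strategy N) (π : Fin N → Strategy N) (i : Fin N)
    (Φ : List (Dist N) → Profile N → ℝ) (B : ℝ) (hB : ∀ h θ, B ≤ Φ h θ)
    (hΦ : ∀ h θ, (1 - δ) * stagePayoff b c i θ (fun j => π j h (ratingDist θ)) +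
      δ * ∑ θ', stateTrans ε τ θ (π₀ h (ratingDist θ)) (fun j => π j h (ratingDist θ)) θ' *
        Φ (h ++ [ratingDist θ]) θ' ≤ Φ h θ) (h : List (Dist N)) (θ : Profile N) :
    valueAt b c ε δ τ π₀ π i h θ ≤ Φ h θ := by
  have hV := fun h θ => abs_le.1 (abs_valueAt_le (τ := τ) hN hb hc hε hε' hδ hδ' π₀ π i h θ)
  refine sub_nonneg.1 (nonneg_of_excessive (τ := τ) hN hε hε' hδ hδ' π₀ π
    (fun h θ => Φ h θ - valueAt b c ε δ τ π₀ π i h θ) (B - (b + c))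
    (fun h θ => by linarith [hB h θ, (hV h θ).2]) (fun h θ => ?_) h θ)
  have h1 := hΦ h θ
  have h2 := valueAt_eq (τ := τ) hN hb hc hε hε' hδ hδ' π₀ π i h θ
  simp only [mul_sub, Finset.sum_sub_distrib]
  linarith

lemma le_valueAt (hN : 2 ≤ N) (hb : 0 ≤ b) (hc : 0 ≤ c) (hε : 0 < ε) (hε' : ε < 1 / 2)
    (hδ : 0 ≤ δ) (hδ' : δ < 1) (π₀ : Strategy N) (π : Fin N → Strategy N) (i : Fin N)
    (Φ : List (Dist N) → Profile N → ℝ) (B : ℝ) (hB : ∀ h θ, Φ h θ ≤ B)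
    (hΦ : ∀ h θ, Φ h θ ≤ (1 - δ) * stagePayoff b c i θ (fun j => π j h (ratingDist θ)) +
      δ * ∑ θ', stateTrans ε τ θ (π₀ h (ratingDist θ)) (fun j => π j h (ratingDist θ)) θ' *
        Φ (h ++ [ratingDist θ]) θ') (h : List (Dist N)) (θ : Profile N) :
    Φ h θ ≤ valueAt b c ε δ τ π₀ π i h θ := by
  have hV := fun h θ => abs_le.1 (abs_valueAt_le (τ := τ) hN hb hc hε hε' hδ hδ' π₀ π i h θ)
  refine sub_nonneg.1 (nonneg_of_excessive (τ := τ) hN hε hε' hδ hδ' π₀ π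
    (fun h θ => valueAt b c ε δ τ π₀ π i h θ - Φ h θ) (-(b + c) - B)
    (fun h θ => by linarith [hB h θ, (hV h θ).1]) (fun h θ => ?_) h θ)
  have h1 := hΦ h θ
  have h2 := valueAt_eq (τ := τ) hN hb hc hε hε' hδ hδ' π₀ π i h θ
  simp only [mul_sub, Finset.sum_sub_distrib]
  linarith

/-! ### Deviations by a single user -/

/-- The probability that user `i` gives high quality when he uses the plan `α`. -/
noncomputable def serveProb (θ : Profile N) (i : Fin N) (α : Plan) : ℝ :=
  matchAvg N fun m => ((α (θ (m.symm i)) (θ i) : ℕ) : ℝ)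

lemma update_const_self {α : Plan} (i : Fin N) :
    Function.update (fun _ : Fin N => α) i α = fun _ => α :=
  Function.update_eq_self i (fun _ => α)

lemma serveProb_nonneg (θ : Profile N) (i : Fin N) (α : Plan) : 0 ≤ serveProb θ i α :=
  div_nonneg (Finset.sum_nonneg fun _ _ => Nat.cast_nonneg _) (Nat.cast_nonneg _)

lemma serveProb_altruistic (hN : 2 ≤ N) (θ : Profile N) (i : Fin N) :
    serveProb θ i altruistic = 1 := by
  simpa [serveProb, altruistic] using matchAvg_const hN 1

lemma serveProb_selfish (hN : 2 ≤ N) (θ : Profile N) (i : Fin N) :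
    serveProb θ i selfish = 0 := by
  simpa [serveProb, selfish] using matchAvg_const hN 0

lemma stagePayoff_update_altruistic (hN : 2 ≤ N) (i : Fin N) (θ : Profile N) (α : Plan) :
    stagePayoff b c i θ (Function.update (fun _ => altruistic) i α) =
      b - c * serveProb θ i α := by
  unfold stagePayoff serveProb
  rw [sub_eq_add_neg, ← neg_mul, ← matchAvg_affine hN]
  refine matchAvg_congr fun m hm => ?_
  rw [Function.update_of_ne (hm i), Function.update_self]
  simp [altruistic, sub_eq_add_neg]

lemma stagePayoff_update_selfish (hN : 2 ≤ N) (i : Fin N) (θ : Profile N) (α : Plan) :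
    stagePayoff b c i θ (Function.update (fun _ => selfish) i α) = -(c * serveProb θ i α) := by
  unfold stagePayoff serveProb
  rw [← zero_add (-_), ← neg_mul, ← matchAvg_affine hN]
  refine matchAvg_congr fun m hm => ?_
  rw [Function.update_of_ne (hm i), Function.update_self]
  simp [selfish]

/-! ### The upper bound on equilibrium values -/

/-- After every history the equilibrium value is at most `max (b - c - c ε / (1 - 2ε)) 0`. If `M`
bounds all continuation values and `x ≥ 0` denotes the shortfall of the continuation value from
`M`, deterring total shirking in an altruistic period requires
`δ (E' x - E x) ≥ (1 - δ) c`, where `E'` is the expectation under shirking; as `E' x` is at most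
`(1 - ε) / ε * E x`, the expected shortfall costs at least `(1 - δ) c ε / (1 - 2ε)`. -/
lemma IsPAE.valueAt_le (hN : 2 ≤ N) (hb : 0 ≤ b) (hc : 0 ≤ c) (hε : 0 < ε) (hε' : ε < 1 / 2)
    (hδ : 0 ≤ δ) (hδ' : δ < 1) {π₀ : Strategy N} (hB : π₀ ∈ strategiesIn planAS)
    (hπ : IsPAE b c ε δ τ π₀) (i : Fin N) (h : List (Dist N)) (θ : Profile N) :
    valueAt b c ε δ τ π₀ (fun _ => π₀) i h θ ≤ max (b - c - c * (ε / (1 - 2 * ε))) 0 := by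
  set w := max (b - c - c * (ε / (1 - 2 * ε))) 0 with hw
  set V := valueAt b c ε δ τ π₀ (fun _ => π₀) i with hVdef
  have hV := fun h θ => abs_le.1
    (abs_valueAt_le (τ := τ) hN hb hc hε hε' hδ hδ' π₀ (fun _ => π₀) i h θ)
  have hp : 0 < 1 - 2 * ε := by linarith
  have := nonneg_of_discounted hδ' (fun p : List (Dist N) × Profile N => w - V p.1 p.2)
    (w - (b + c)) (fun p => by linarith [(hV p.1 p.2).2]) ?_ (h, θ)
  · simpa using this
  rintro ⟨h, θ⟩ m hm
  simp only
  set q := ratingDist θ with hq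
  have hx : ∀ θ', 0 ≤ w - m - V (h ++ [q]) θ' := fun θ' => by
    have := hm (h ++ [q], θ'); simp only at this; linarith
  have hexp : ∀ α₀ α, ∑ θ', stateTrans ε τ θ α₀ α θ' * (w - m - V (h ++ [q]) θ') =
      w - m - ∑ θ', stateTrans ε τ θ α₀ α θ' * V (h ++ [q]) θ' := fun α₀ α => by
    simp only [mul_sub, Finset.sum_sub_distrib, ← Finset.sum_mul, sum_stateTrans hN, one_mul]
  have hrec := valueAt_eq (τ := τ) hN hb hc hε hε' hδ hδ' π₀ (fun _ => π₀) i h θ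
  rw [← hVdef, ← hq] at hrec
  rcases hB h q with ha | hs
  · set π' : Strategy N := fun k s => if k = [] then selfish else π₀ (h ++ k) s with hπ'
    have hIC : valueAt b c ε δ τ (continuation π₀ h)
        (Function.update (fun _ => continuation π₀ h) i π') i [] θ ≤
        valueAt b c ε δ τ (continuation π₀ h) (fun _ => continuation π₀ h) i [] θ := hπ h θ i π'
    have hfollow : valueAt b c ε δ τ (continuation π₀ h) (fun _ => continuation π₀ h) i [] θ =
        V h θ := valueAt_congr (by simp [continuation]) (by simp [continuation]) i θ
    have hdev : ∀ θ', valueAt b c ε δ τ (continuation π₀ h)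
        (Function.update (fun _ => continuation π₀ h) i π') i ([] ++ [q]) θ' =
        V (h ++ [q]) θ' := fun θ' => by
      refine valueAt_congr (by simp [continuation]) ?_ i θ'
      intro j k s
      by_cases hj : j = i
      · subst hj; simp [hπ']
      · simp [Function.update_of_ne hj, continuation]
    have hplan : (fun j => Function.update (fun _ => continuation π₀ h) i π' j [] q) =
        Function.update (fun _ => altruistic) i selfish := by
      funext j
      by_cases hj : j = i
      · subst hj; simp [hπ']
      · simp [Function.update_of_ne hj, continuation, ha]
    have hcont : continuation π₀ h [] q = altruistic := by simp [continuation, ha]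
    rw [hfollow, valueAt_eq hN hb hc hε hε' hδ hδ', ← hq, hplan, hcont] at hIC
    simp only [hdev] at hIC
    rw [ha] at hrec
    have hstage := stagePayoff_update_altruistic (b := b) (c := c) hN i θ altruistic
    rw [update_const_self, serveProb_altruistic hN] at hstage
    rw [stagePayoff_update_altruistic hN, serveProb_selfish hN] at hIC
    rw [hstage] at hrec
    have hratio : ∑ θ', stateTrans ε τ θ altruistic (Function.update (fun _ => altruistic) i
        selfish) θ' * (w - m - V (h ++ [q]) θ') ≤ (1 - ε) / ε *
        ∑ θ', stateTrans ε τ θ altruistic (fun _ => altruistic) θ' *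
          (w - m - V (h ++ [q]) θ') := by
      rw [Finset.mul_sum]
      refine Finset.sum_le_sum fun θ' _ => ?_
      rw [← mul_assoc]
      exact mul_le_mul_of_nonneg_right (stateTrans_update_le hε hε' _ _ _ _ _ _ _) (hx θ')
    rw [hexp, hexp] at hratio
    set E := ∑ θ', stateTrans ε τ θ altruistic (fun _ => altruistic) θ' * V (h ++ [q]) θ'
    set E' := ∑ θ', stateTrans ε τ θ altruistic (Function.update (fun _ => altruistic) i
        selfish) θ' * V (h ++ [q]) θ'
    have h1 : ε * (w - m - E') ≤ (1 - ε) * (w - m - E) := by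
      rw [div_mul_eq_mul_div, le_div_iff₀ hε] at hratio; linarith
    have h2 : (1 - δ) * c ≤ δ * (E - E') := by linarith
    have h3 : (1 - δ) * (c * ε) ≤ δ * ((1 - 2 * ε) * (w - m - E)) := by
      have := mul_le_mul_of_nonneg_left h1 hδ
      have := mul_le_mul_of_nonneg_left h2 hε.le
      linarith
    have h4 : (1 - δ) * (c * (ε / (1 - 2 * ε))) ≤ δ * (w - m - E) := by
      rw [← mul_div_assoc, ← mul_div_assoc, div_le_iff₀ hp]; linarith
    have h5 : (1 - δ) * (b - c - c * (ε / (1 - 2 * ε))) ≤ (1 - δ) * w :=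
      mul_le_mul_of_nonneg_left (le_max_left _ _) (by linarith)
    linarith
  · have hs : π₀ h q = selfish := hs
    rw [hs] at hrec
    have hstage := stagePayoff_update_selfish (b := b) (c := c) hN i θ selfish
    rw [update_const_self, serveProb_selfish hN] at hstage
    rw [hstage] at hrec
    have h1 : 0 ≤ ∑ θ', stateTrans ε τ θ selfish (fun _ => selfish) θ' *
        (w - m - V (h ++ [q]) θ') := Finset.sum_nonneg fun θ' _ =>
      mul_nonneg (stateTrans_nonneg hε hε' _ _ _ _ _) (hx θ')
    rw [hexp] at h1
    have h2 := mul_le_mul_of_nonneg_left h1 hδ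
    have h3 : 0 ≤ (1 - δ) * w := mul_nonneg (by linarith) (le_max_right _ _)
    linarith

/-! ### Computation of the loss -/

/-- The update rule under which the new rating is `1` exactly when the report is not lower than
recommended. -/
noncomputable def reportRule : UpdateRule := ⟨fun _ => 1, fun _ => 1⟩

lemma serverProb_reportRule_zero (ε : ℝ) (θc θs : Rating) (q : Quality) :
    serverProb ε reportRule altruistic 0 θc θs q =
      (1 - ε) + -(1 - 2 * ε) * ((q : ℕ) : ℝ) := by
  fin_cases q <;>
    simp [serverProb, Fin.sum_univ_two, reportProb, updateProb, reportRule, altruistic]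
  ring

/-- Under `reportRule`, the event that all ratings drop to `0` has the extreme likelihood ratio
`(1 - ε) / ε` against every user. -/
lemma stateTrans_reportRule_zero (hN : 2 ≤ N) (ε : ℝ) (θ : Profile N) (i : Fin N) (α : Plan) :
    stateTrans ε reportRule θ altruistic (Function.update (fun _ => altruistic) i α)
      (fun _ => 0) = ε ^ (N - 1) * ((1 - ε) - (1 - 2 * ε) * serveProb θ i α) := by
  unfold stateTrans serveProb
  rw [sub_eq_add_neg _ (_ * _), ← neg_mul, ← matchAvg_affine hN, ← matchAvg_mul_left]
  refine matchAvg_congr fun m _ => ?_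
  rw [← Finset.prod_erase_mul Finset.univ _ (Finset.mem_univ i)]
  congr 1
  · rw [Finset.prod_congr rfl (g := fun _ => ε), Finset.prod_const]
    · simp
    · intro j hj
      rw [Function.update_of_ne (Finset.ne_of_mem_erase hj), serverProb_reportRule_zero]
      simp [altruistic]; ring
  · rw [Function.update_self, serverProb_reportRule_zero]

lemma ratingDist_eq_zero_iff (θ : Profile N) : ratingDist θ = 0 ↔ θ = fun _ => 0 := by
  simp only [ratingDist, Fin.ext_iff, Fin.val_zero, Finset.card_eq_zero,
    Finset.filter_eq_empty_iff, Finset.mem_univ, true_implies, funext_iff]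
  refine forall_congr' fun i => ?_
  generalize θ i = r
  fin_cases r <;> simp

lemma distTrans_zero (ε : ℝ) (τ : UpdateRule) (θ : Profile N) (α₀ : Plan) (α : Fin N → Plan) :
    distTrans ε τ θ α₀ α {0} = stateTrans ε τ θ α₀ α (fun _ => 0) := by
  unfold distTrans
  rw [Finset.filter_congr (q := fun θ' => θ' = fun _ => 0)
    (by simp [ratingDist_eq_zero_iff])]
  simp [Finset.filter_eq']

lemma distTrans_compl (hN : 2 ≤ N) (ε : ℝ) (τ : UpdateRule) (θ : Profile N) (α₀ : Plan)
    (α : Fin N → Plan) (T : Finset (Dist N)) :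
    distTrans ε τ θ α₀ α Tᶜ = 1 - distTrans ε τ θ α₀ α T := by
  unfold distTrans
  rw [← sum_stateTrans hN ε τ θ α₀ α, eq_sub_iff_add_eq, add_comm]
  simp only [Finset.mem_compl]
  exact Finset.sum_filter_add_sum_filter_not _ _ _

lemma gap_eq (hN : 2 ≤ N) (ε : ℝ) (τ : UpdateRule) (θ : Profile N) (α₀ : Plan)
    (T : Finset (Dist N)) (i : Fin N) (D : Finset Rating) :
    gap ε τ θ α₀ T i D =
      distTrans ε τ θ α₀ (Function.update (fun _ => altruistic) i (refuse D)) T -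
        distTrans ε τ θ α₀ (fun _ => altruistic) T := by
  unfold gap
  rw [distTrans_compl hN, distTrans_compl hN]
  ring

lemma clientProb_eq_one (hN : 2 ≤ N) (θ : Profile N) (i : Fin N) (D : Finset Rating)
    (hD : ∀ j, θ j ∈ D) : clientProb θ i D = 1 := by
  have hN' : (2 : ℝ) ≤ N := by exact_mod_cast hN
  have : ((Finset.univ.filter fun j => j ≠ i).card : ℝ) = (N : ℝ) - 1 := by
    rw [Finset.filter_ne', Finset.card_erase_of_mem (Finset.mem_univ i), Finset.card_univ,
      Fintype.card_fin, Nat.cast_sub (by omega), Nat.cast_one]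
  simp only [clientProb, hD, and_true, this]
  exact div_self (by linarith)

lemma clientProb_eq_zero (θ : Profile N) (i : Fin N) (D : Finset Rating)
    (hD : ∀ j, θ j ∉ D) : clientProb θ i D = 0 := by
  simp [clientProb, hD]

lemma le_of_mem_lossValues (hN : 2 ≤ N) (hε : 0 < ε) (hε' : ε < 1 / 2) {x : ℝ}
    (hx : x ∈ lossValues N ε) : ε / (1 - 2 * ε) ≤ x := by
  obtain ⟨τ, θ, α₀, T, -, hdet, rfl⟩ := hx
  have hp : 0 < 1 - 2 * ε := by linarith
  have hone : clientProb θ ⟨0, by omega⟩ Finset.univ = 1 :=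
    clientProb_eq_one hN θ _ _ fun _ => Finset.mem_univ _
  have hg := hdet ⟨0, by omega⟩ Finset.univ (by rw [hone]; exact one_pos)
  have hρ : 1 / gap ε τ θ α₀ T ⟨0, by omega⟩ Finset.univ ≤ rho ε τ θ α₀ T := by
    rw [← hone]
    exact le_ciSup (f := fun p : Fin N × {D : Finset Rating // D.Nonempty} =>
      clientProb θ p.1 p.2 / gap ε τ θ α₀ T p.1 p.2) (Set.finite_range _).bddAbove
      (⟨0, by omega⟩, ⟨Finset.univ, Finset.univ_nonempty⟩)
  set g := gap ε τ θ α₀ T ⟨0, by omega⟩ Finset.univ with hgdef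
  have hQ0 : 0 ≤ distTrans ε τ θ α₀ (fun _ => altruistic) T :=
    Finset.sum_nonneg fun _ _ => stateTrans_nonneg hε hε' _ _ _ _ _
  have hle : distTrans ε τ θ α₀ (Function.update (fun _ => altruistic) ⟨0, by omega⟩
      (refuse Finset.univ)) T ≤ (1 - ε) / ε * distTrans ε τ θ α₀ (fun _ => altruistic) T := by
    unfold distTrans
    rw [Finset.mul_sum]
    exact Finset.sum_le_sum fun _ _ => stateTrans_update_le hε hε' _ _ _ _ _ _ _
  have hge := gap_eq hN ε τ θ α₀ T ⟨0, by omega⟩ Finset.univ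
  rw [← hgdef] at hge
  set Q := distTrans ε τ θ α₀ (fun _ => altruistic) T
  refine le_trans ?_ (mul_le_mul_of_nonneg_right hρ hQ0)
  rw [div_mul_eq_mul_div, one_mul, div_le_div_iff₀ hp hg]
  rw [div_mul_eq_mul_div, le_div_iff₀ hε] at hle
  rw [hge]
  linarith

/-- The smallest loss is attained at the profile in which all ratings are `1`, under `reportRule`
and with punishment exactly when all reports are low. -/
lemma mem_lossValues (hN : 2 ≤ N) (hε : 0 < ε) (hε' : ε < 1 / 2) :
    ε / (1 - 2 * ε) ∈ lossValues N ε := by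
  have hp : 0 < 1 - 2 * ε := by linarith
  have hpow : 0 < ε ^ (N - 1) := pow_pos hε _
  set θ : Profile N := fun _ => 1 with hθ
  have hdist : ∀ i α, distTrans ε reportRule θ altruistic
      (Function.update (fun _ => altruistic) i α) {0} =
        ε ^ (N - 1) * ((1 - ε) - (1 - 2 * ε) * serveProb θ i α) := fun i α => by
    rw [distTrans_zero, stateTrans_reportRule_zero hN]
  have hbase : distTrans ε reportRule θ altruistic (fun _ => altruistic) {0} =
      ε ^ (N - 1) * ε := by
    have := hdist ⟨0, by omega⟩ altruistic
    rw [update_const_self, serveProb_altruistic hN] at this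
    rw [this]; ring
  have hgap : ∀ i D, (1 : Rating) ∈ D →
      gap ε reportRule θ altruistic {0} i D = ε ^ (N - 1) * (1 - 2 * ε) := fun i D hD => by
    have : serveProb θ i (refuse D) = 0 := by
      simpa [serveProb, refuse, hθ, hD] using matchAvg_const hN 0
    rw [gap_eq hN, hdist, hbase, this]; ring
  have hcl : ∀ i D, (1 : Rating) ∈ D → clientProb θ i D = 1 := fun i D hD =>
    clientProb_eq_one hN θ i D fun _ => hD
  have hcl0 : ∀ i D, (1 : Rating) ∉ D → clientProb θ i D = 0 := fun i D hD =>
    clientProb_eq_zero θ i D fun _ => hD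
  have hρ : rho ε reportRule θ altruistic {0} = 1 / (ε ^ (N - 1) * (1 - 2 * ε)) := by
    have : Nonempty (Fin N × {D : Finset Rating // D.Nonempty}) :=
      ⟨(⟨0, by omega⟩, ⟨{1}, Finset.singleton_nonempty _⟩)⟩
    refine le_antisymm (ciSup_le fun p => ?_) ?_
    · by_cases hD : (1 : Rating) ∈ p.2.1
      · rw [hcl _ _ hD, hgap _ _ hD]
      · rw [hcl0 _ _ hD, zero_div]; positivity
    · have := le_ciSup (f := fun p : Fin N × {D : Finset Rating // D.Nonempty} =>
        clientProb θ p.1 p.2 / gap ε reportRule θ altruistic {0} p.1 p.2)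
        (Set.finite_range _).bddAbove (⟨0, by omega⟩, ⟨{1}, Finset.singleton_nonempty _⟩)
      simp only [hcl _ _ (Finset.mem_singleton_self _),
        hgap _ _ (Finset.mem_singleton_self _)] at this
      exact this
  refine ⟨reportRule, θ, altruistic, {0}, Or.inl rfl, fun i D hD => ?_, ?_⟩
  · by_cases h1 : (1 : Rating) ∈ D
    · rw [hgap _ _ h1]; positivity
    · rw [hcl0 _ _ h1] at hD; exact absurd hD (lt_irrefl _)
  · rw [hρ, hbase]; field_simp

lemma zeta_eq (hN : 2 ≤ N) (b c : ℝ) (hε : 0 < ε) (hε' : ε < 1 / 2) :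
    zeta N b c ε = min (b - c) (c * (ε / (1 - 2 * ε))) := by
  have : IsLeast (lossValues N ε) (ε / (1 - 2 * ε)) :=
    ⟨mem_lossValues hN hε hε', fun _ => le_of_mem_lossValues hN hε hε'⟩
  rw [zeta, this.csInf_eq]

/-! ### Equilibria from promised values -/

/-- If `Φ h s` is a bounded system of promised values that is kept when everybody follows `π₀`, and
that no user can beat by changing his plan in a single period, then `π₀` is an equilibrium with
these values. -/
lemma isPAE_and_valueAt_eq_of_promises (hN : 2 ≤ N) (hb : 0 ≤ b) (hc : 0 ≤ c) (hε : 0 < ε)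
    (hε' : ε < 1 / 2) (hδ : 0 ≤ δ) (hδ' : δ < 1) (π₀ : Strategy N)
    (Φ : List (Dist N) → Dist N → ℝ) (B B' : ℝ) (hB : ∀ h s, B ≤ Φ h s)
    (hB' : ∀ h s, Φ h s ≤ B')
    (hdev : ∀ h θ i α, (1 - δ) * stagePayoff b c i θ
        (Function.update (fun _ => π₀ h (ratingDist θ)) i α) +
      δ * ∑ θ', stateTrans ε τ θ (π₀ h (ratingDist θ))
        (Function.update (fun _ => π₀ h (ratingDist θ)) i α) θ' *
          Φ (h ++ [ratingDist θ]) (ratingDist θ') ≤ Φ h (ratingDist θ))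
    (hkeep : ∀ h θ i, Φ h (ratingDist θ) ≤
      (1 - δ) * stagePayoff b c i θ (fun _ => π₀ h (ratingDist θ)) +
      δ * ∑ θ', stateTrans ε τ θ (π₀ h (ratingDist θ)) (fun _ => π₀ h (ratingDist θ)) θ' *
          Φ (h ++ [ratingDist θ]) (ratingDist θ')) :
    IsPAE b c ε δ τ π₀ ∧ ∀ i h θ, valueAt b c ε δ τ π₀ (fun _ => π₀) i h θ =
      Φ h (ratingDist θ) := by
  have hlow : ∀ i h θ, Φ h (ratingDist θ) ≤ valueAt b c ε δ τ π₀ (fun _ => π₀) i h θ :=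
    fun i => le_valueAt hN hb hc hε hε' hδ hδ' π₀ (fun _ => π₀) i
      (fun h θ => Φ h (ratingDist θ)) B' (fun _ _ => hB' _ _) (fun h θ => hkeep h θ i)
  have hup : ∀ i π' h k θ, valueAt b c ε δ τ (continuation π₀ h)
      (Function.update (fun _ => continuation π₀ h) i π') i k θ ≤ Φ (h ++ k) (ratingDist θ) := by
    intro i π' h
    refine valueAt_le hN hb hc hε hε' hδ hδ' _ _ i
      (fun k θ => Φ (h ++ k) (ratingDist θ)) B (fun _ _ => hB _ _) (fun k θ => ?_)
    have hplan : (fun j => Function.update (fun _ => continuation π₀ h) i π' j k (ratingDist θ)) =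
        Function.update (fun _ => π₀ (h ++ k) (ratingDist θ)) i (π' k (ratingDist θ)) := by
      funext j
      by_cases hj : j = i
      · subst hj; simp
      · simp [Function.update_of_ne hj, continuation]
    rw [hplan]
    simpa [continuation] using hdev (h ++ k) θ i (π' k (ratingDist θ))
  have hshift : ∀ i h θ, valueAt b c ε δ τ (continuation π₀ h) (fun _ => continuation π₀ h) i [] θ
      = valueAt b c ε δ τ π₀ (fun _ => π₀) i h θ := fun i h θ =>
    valueAt_congr (by simp [continuation]) (by simp [continuation]) i θ
  refine ⟨fun h θ i π' => ?_, fun i h θ => le_antisymm ?_ (hlow i h θ)⟩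
  · refine (hup i π' h [] θ).trans ?_
    rw [List.append_nil]
    exact (hlow i h θ).trans (hshift i h θ).ge
  · have := hup i (continuation π₀ h) h [] θ
    rwa [Function.update_eq_self i (fun _ => continuation π₀ h), hshift, List.append_nil] at this

lemma mem_equilibriumWelfares (hN : 2 ≤ N) {π₀ : Strategy N} (hB : π₀ ∈ strategiesIn planAS)
    (hπ : IsPAE b c ε δ τ π₀)
    (hV : ∀ i θ, valueAt b c ε δ τ π₀ (fun _ => π₀) i [] θ = w) :
    w ∈ equilibriumWelfares N b c ε δ planAS := by
  refine ⟨τ, π₀, hB, hπ, ?_⟩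
  have hV' : ∀ i θ, discountedPayoff b c ε δ τ i θ π₀ (fun _ => π₀) = w := hV
  have hN' : (N : ℝ) ≠ 0 := by positivity
  simp [worstWelfare, hV', hN']

/-- Zero welfare is attained by recommending the selfish plan forever. -/
lemma zero_mem_equilibriumWelfares (hN : 2 ≤ N) (hb : 0 ≤ b) (hc : 0 ≤ c) (hε : 0 < ε)
    (hε' : ε < 1 / 2) (hδ : 0 ≤ δ) (hδ' : δ < 1) :
    0 ∈ equilibriumWelfares N b c ε δ planAS := by
  obtain ⟨h1, h2⟩ := isPAE_and_valueAt_eq_of_promises (τ := reportRule) hN hb hc hε hε' hδ hδ'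
    (fun _ _ => selfish) (fun _ _ => 0) 0 0 (fun _ _ => le_rfl) (fun _ _ => le_rfl)
    (fun h θ i α => by
      rw [stagePayoff_update_selfish hN]
      have := mul_nonneg (mul_nonneg (sub_nonneg.2 hδ'.le) hc) (serveProb_nonneg θ i α)
      simp only [mul_zero, Finset.sum_const_zero, add_zero]
      linarith)
    (fun h θ i => by
      have := stagePayoff_update_selfish (b := b) (c := c) hN i θ selfish
      rw [update_const_self, serveProb_selfish hN] at this
      simp [this])
  exact mem_equilibriumWelfares hN (fun _ _ => Or.inr rfl) h1 fun i θ => h2 i [] θ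

/-! ### The optimal equilibrium for patient users -/

/-- The plan recommended at the promised value `v`, where `w` is the largest promise: promises up
to `δ w` are kept by a selfish period, larger ones by an altruistic period. -/
noncomputable def promisePlan (w δ v : ℝ) : Plan := if v ≤ δ * w then selfish else altruistic

/-- The promise for the next period after the promise `v`, when the next rating distribution is
`s`: an altruistic period is followed by a reduction by `x` if all ratings have dropped to `0`. -/
noncomputable def nextPromise (w x δ v : ℝ) (s : Dist N) : ℝ :=
  if v ≤ δ * w then v / δ else (v - (1 - δ) * w) / δ - if s = 0 then x else 0

/-- The promised value after the history `h` of past distributions at the current distribution `s`.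
The promise starts at `w` whatever the initial distribution is, hence the `tail`. -/
noncomputable def promise (w x δ : ℝ) (h : List (Dist N)) (s : Dist N) : ℝ :=
  (h ++ [s]).tail.foldl (nextPromise w x δ) w

lemma promise_append (w x δ : ℝ) (h : List (Dist N)) (s s' : Dist N) :
    promise w x δ (h ++ [s]) s' = nextPromise w x δ (promise w x δ h s) s' := by
  unfold promise
  rw [List.tail_append_of_ne_nil (by simp), List.foldl_append]
  rfl

lemma nextPromise_mem (hδ : 0 < δ) (hx : 0 ≤ x) (hxw : δ * x ≤ (2 * δ - 1) * w)
    (hv : v ∈ Set.Icc 0 w) (s : Dist N) : nextPromise w x δ v s ∈ Set.Icc 0 w := by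
  unfold nextPromise
  obtain ⟨h0, h1⟩ := hv
  split_ifs with h hs
  · exact ⟨by positivity, by rw [div_le_iff₀ hδ]; linarith⟩
  · have : x ≤ (v - (1 - δ) * w) / δ := by rw [le_div_iff₀ hδ]; linarith
    have : (v - (1 - δ) * w) / δ ≤ w := by rw [div_le_iff₀ hδ]; linarith
    constructor <;> linarith
  · have : x ≤ (v - (1 - δ) * w) / δ := by rw [le_div_iff₀ hδ]; linarith
    have : (v - (1 - δ) * w) / δ ≤ w := by rw [div_le_iff₀ hδ]; linarith
    constructor <;> linarith

lemma promise_mem (hδ : 0 < δ) (hw : 0 ≤ w) (hx : 0 ≤ x) (hxw : δ * x ≤ (2 * δ - 1) * w)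
    (h : List (Dist N)) (s : Dist N) : promise w x δ h s ∈ Set.Icc 0 w := by
  induction h using List.reverseRecOn generalizing s with
  | nil => exact ⟨hw, le_rfl⟩
  | append_singleton h s' ih =>
    rw [promise_append]
    exact nextPromise_mem hδ hx hxw (ih s') s

/-- The reduction `x` makes every user indifferent between all his plans in an altruistic period,
while in a selfish period high quality only costs. -/
lemma promise_bellman (hN : 2 ≤ N) (hε' : ε < 1 / 2) (hδ : 0 < δ)
    (hw : w = b - c - c * (ε / (1 - 2 * ε)))
    (hx : δ * x * (ε ^ (N - 1) * (1 - 2 * ε)) = (1 - δ) * c)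
    (v : ℝ) (θ : Profile N) (i : Fin N) (α : Plan) :
    (1 - δ) * stagePayoff b c i θ (Function.update (fun _ => promisePlan w δ v) i α) +
      δ * ∑ θ', stateTrans ε reportRule θ (promisePlan w δ v)
        (Function.update (fun _ => promisePlan w δ v) i α) θ' *
          nextPromise w x δ v (ratingDist θ') =
      v - if v ≤ δ * w then (1 - δ) * (c * serveProb θ i α) else 0 := by
  have hp : 0 < 1 - 2 * ε := by linarith
  unfold promisePlan nextPromise
  by_cases h : v ≤ δ * w
  · simp only [if_pos h, ← Finset.sum_mul, sum_stateTrans hN, stagePayoff_update_selfish hN]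
    field_simp
    ring
  · simp only [if_neg h, mul_sub, Finset.sum_sub_distrib, ← Finset.sum_mul, sum_stateTrans hN,
      stagePayoff_update_altruistic hN, ratingDist_eq_zero_iff, mul_ite, mul_zero,
      Finset.sum_ite_eq', Finset.mem_univ, if_true, stateTrans_reportRule_zero hN]
    set P := serveProb θ i α
    have e1 : δ * (1 * ((v - (1 - δ) * w) / δ)) = v - (1 - δ) * w := by field_simp
    have hr : ε / (1 - 2 * ε) * (1 - 2 * ε) = ε := div_mul_cancel₀ _ hp.ne'
    generalize ε / (1 - 2 * ε) = r at hw hr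
    have e2 : δ * (ε ^ (N - 1) * (1 - ε - (1 - 2 * ε) * P) * x) = (1 - δ) * c * (1 + r - P) := by
      linear_combination (1 + r - P) * hx - δ * x * ε ^ (N - 1) * hr
    linear_combination e1 - e2 - (1 - δ) * hw

lemma mem_equilibriumWelfares_of_patient (hN : 2 ≤ N) (hb : 0 ≤ b) (hc : 0 ≤ c) (hε : 0 < ε)
    (hε' : ε < 1 / 2) (hδ : 0 < δ) (hδ' : δ < 1)
    (hw : w = b - c - c * (ε / (1 - 2 * ε))) (hw0 : 0 ≤ w)
    (hpat : (1 - δ) * c / (ε ^ (N - 1) * (1 - 2 * ε)) ≤ (2 * δ - 1) * w) :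
    w ∈ equilibriumWelfares N b c ε δ planAS := by
  have hp : 0 < 1 - 2 * ε := by linarith
  have h1δ : 0 ≤ 1 - δ := by linarith
  have hpow : 0 < ε ^ (N - 1) := pow_pos hε _
  set x := (1 - δ) * c / (ε ^ (N - 1) * (1 - 2 * ε)) / δ with hxdef
  have hδx : δ * x = (1 - δ) * c / (ε ^ (N - 1) * (1 - 2 * ε)) := by
    rw [hxdef, mul_div_cancel₀ _ hδ.ne']
  have hx : δ * x * (ε ^ (N - 1) * (1 - 2 * ε)) = (1 - δ) * c := by
    rw [hδx]; field_simp
  have hx0 : 0 ≤ x := by positivity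
  have hmem := fun h (s : Dist N) => promise_mem hδ hw0 hx0 (hδx.trans_le hpat) h s
  have hbell := promise_bellman hN hε' hδ hw hx
  obtain ⟨h1, h2⟩ := isPAE_and_valueAt_eq_of_promises (τ := reportRule) hN hb hc hε hε' hδ.le hδ'
    (fun h s => promisePlan w δ (promise w x δ h s)) (promise w x δ) 0 w
    (fun h s => (hmem h s).1) (fun h s => (hmem h s).2)
    (fun h θ i α => by
      simp only [promise_append]
      rw [hbell]
      have := mul_nonneg h1δ (mul_nonneg hc (serveProb_nonneg θ i α))
      split_ifs <;> linarith)
    (fun h θ i => by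
      simp only [promise_append]
      have := hbell (promise w x δ h (ratingDist θ)) θ i
        (promisePlan w δ (promise w x δ h (ratingDist θ)))
      rw [update_const_self] at this
      rw [this]
      split_ifs with hv
      · simp [promisePlan, hv, serveProb_selfish hN]
      · simp)
  refine mem_equilibriumWelfares hN (fun h s => ?_) h1 fun i θ => h2 i [] θ
  unfold promisePlan
  split_ifs
  · exact Or.inr rfl
  · exact Or.inl rfl

lemma le_of_mem_equilibriumWelfares (hN : 2 ≤ N) (hb : 0 ≤ b) (hc : 0 ≤ c) (hε : 0 < ε)
    (hε' : ε < 1 / 2) (hδ : 0 ≤ δ) (hδ' : δ < 1) {y : ℝ}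
    (hy : y ∈ equilibriumWelfares N b c ε δ planAS) :
    y ≤ max (b - c - c * (ε / (1 - 2 * ε))) 0 := by
  obtain ⟨τ, π₀, hB, hπ, rfl⟩ := hy
  have hN' : (0 : ℝ) < N := by positivity
  refine (ciInf_le (Set.finite_range _).bddBelow (fun _ => 0)).trans ?_
  rw [div_mul_eq_mul_div, one_mul, div_le_iff₀ hN', mul_comm]
  refine (Finset.sum_le_card_nsmul Finset.univ _ _ fun i _ =>
    hπ.valueAt_le hN hb hc hε hε' hδ hδ' hB i [] _).trans_eq ?_
  simp

end RatingMechanism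

theorem proposition1 (N : ℕ) (hN : 2 ≤ N) (b c : ℝ) (hc : 0 < c) (hcb : c < b)
    (ε : ℝ) (hε : 0 < ε) (hε' : ε < 1 / 2) :
    -- the loss is positive
    0 < zeta N b c ε ∧
    -- the optimal welfare is a genuine supremum for every discount factor
    (∀ δ : ℝ, 0 ≤ δ → δ < 1 →
      IsLUB (equilibriumWelfares N b c ε δ planAS) (optimalWelfare N b c ε δ planAS)) ∧
    -- the limit exists and is bounded away from the social optimum
    ∃ L : ℝ, Tendsto (fun δ : ℝ => optimalWelfare N b c ε δ planAS) (𝓝[<] 1) (𝓝 L) ∧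
      L ≤ b - c - zeta N b c ε := by
  have hb : 0 ≤ b := (hc.trans hcb).le
  have hp : 0 < 1 - 2 * ε := by linarith
  have hzero := fun δ h0 h1 => zero_mem_equilibriumWelfares (δ := δ) hN hb hc.le hε hε' h0 h1
  have hle := fun δ h0 h1 y =>
    le_of_mem_equilibriumWelfares (δ := δ) (y := y) hN hb hc.le hε hε' h0 h1
  have hz : b - c - zeta N b c ε = max (b - c - c * (ε / (1 - 2 * ε))) 0 := by
    rw [zeta_eq hN b c hε hε', sub_eq_iff_eq_add]
    rcases le_total (b - c) (c * (ε / (1 - 2 * ε))) with h | h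
    · rw [min_eq_left h, max_eq_right (by linarith)]; ring
    · rw [min_eq_right h, max_eq_left (by linarith)]; ring
  refine ⟨?_, fun δ h0 h1 => isLUB_csSup ⟨0, hzero δ h0 h1⟩ ⟨_, hle δ h0 h1⟩,
    _, ?_, hz.ge⟩
  · rw [zeta_eq hN b c hε hε']
    exact lt_min (by linarith) (by positivity)
  · refine tendsto_const_nhds.congr' ?_
    have hpos : ∀ᶠ δ : ℝ in 𝓝[<] 1, 0 < δ := nhdsWithin_le_nhds (lt_mem_nhds one_pos)
    -- the maximum is attained, hence is the supremum, as soon as it is a feasible welfare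
    suffices h : ∀ᶠ δ : ℝ in 𝓝[<] 1, max (b - c - c * (ε / (1 - 2 * ε))) 0 ∈
        equilibriumWelfares N b c ε δ planAS by
      filter_upwards [h, hpos, self_mem_nhdsWithin] with δ hδ h0 h1
      exact (IsGreatest.csSup_eq ⟨hδ, hle δ h0.le h1⟩).symm
    rcases le_or_gt (b - c - c * (ε / (1 - 2 * ε))) 0 with hw | hw
    · rw [max_eq_right hw]
      filter_upwards [hpos, self_mem_nhdsWithin] with δ h0 h1
      exact hzero δ h0.le h1
    · rw [max_eq_left hw.le]
      have hpat : ∀ᶠ δ : ℝ in 𝓝[<] 1, (1 - δ) * c / (ε ^ (N - 1) * (1 - 2 * ε)) <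
          (2 * δ - 1) * (b - c - c * (ε / (1 - 2 * ε))) := by
        refine nhdsWithin_le_nhds (ContinuousAt.eventually_lt (by fun_prop) (by fun_prop) ?_)
        rw [sub_self, zero_mul, zero_div]
        linarith
      filter_upwards [hpos, self_mem_nhdsWithin, hpat] with δ h0 h1 h2
      exact mem_equilibriumWelfares_of_patient hN hb hc.le hε hε' h0 h1 rfl hw.le h2.le
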